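/- Let $k$ be a field and let $A$ be a finite-dimensional $k$-algebra; modules are finitely generated left modules. Write $DA=\operatorname{Hom}_k(A,k)$, and for a module $X$ write $\operatorname{add}X$ for the class of direct summands of finite direct sums of copies of $X$. Let $T$ be a cotilting $A$-module, that is, $\operatorname{inj.dim}T<\infty$, $\operatorname{Ext}^i_A(T,T)=0$ for all $i>0$, and there is an exact sequence $0\to T_r\to\cdots\to T_1\to T_0\to DA\to 0$ with all $T_i\in\operatorname{add}T$. Let ${}^{\perp_{>0}}T$ be the full subcategory of $A$-modules $X$ with $\operatorname{Ext}^i_A(X,T)=0$ for all $i>0$. Let $n\ge 0$ be an integer, and assume that the global dimension of $A$ is at most $n$ and that ${}^{\perp_{>0}}T$ has an additive generator $M$, that is, ${}^{\perp_{>0}}T=\operatorname{add}M$. Let $[T]$ be the two-sided ideal of $\operatorname{End}_A(M)$ of all endomorphisms that factor through a module in $\operatorname{add}T$. Then $\operatorname{End}_A(M)/[T]$ has (left and right) global dimension at most $3n-1$. (For $n=0$ this means that $\operatorname{End}_A(M)/[T]=0$.) -/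

import Mathlib

open CategoryTheory

universe u

namespace RelStableAuslander

/-- The left `R`-modules all have projective dimension less than `d`, i.e. the (left) global
dimension of `R` is at most `d - 1`. For `d = 0` this says that every `R`-module is zero,
i.e. that `R` is the zero ring. -/
def HasGlobalDimensionLT (R : Type u) [Ring R] (d : ℕ) : Prop :=
  ∀ N : ModuleCat.{u} R, HasProjectiveDimensionLT N d

/-- The (left) global dimension of `R` is at most `d`. -/
def HasGlobalDimensionLE (R : Type u) [Ring R] (d : ℕ) : Prop :=
  HasGlobalDimensionLT R (d + 1)

section Algebra

variable (k A : Type u) [Field k] [Ring A] [Algebra k A]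

/-- The `k`-dual `D A = Hom_k(A, k)` of the algebra `A`, as a left `A`-module through
`(a • f) x = f (x * a)`. -/
def DualModule : Type u := A →ₗ[k] k

instance : AddCommGroup (DualModule k A) :=
  inferInstanceAs (AddCommGroup (A →ₗ[k] k))

instance : FunLike (DualModule k A) A k :=
  inferInstanceAs (FunLike (A →ₗ[k] k) A k)

instance : Module A (DualModule k A) where
  smul a f := LinearMap.comp (f : A →ₗ[k] k) (LinearMap.mulRight k a)
  one_smul f := LinearMap.ext fun x => congrArg (f : A → k) (mul_one x)
  mul_smul a b f := LinearMap.ext fun x => congrArg (f : A → k) (mul_assoc x a b).symm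
  smul_zero _ := LinearMap.ext fun _ => rfl
  smul_add _ _ _ := LinearMap.ext fun _ => rfl
  add_smul a b f := LinearMap.ext fun x =>
    (congrArg (f : A → k) (mul_add x a b)).trans (LinearMap.map_add (f : A →ₗ[k] k) _ _)
  zero_smul f := LinearMap.ext fun x =>
    (congrArg (f : A → k) (mul_zero x)).trans (LinearMap.map_zero (f : A →ₗ[k] k))

theorem DualModule.smul_apply (a : A) (f : DualModule k A) (x : A) : (a • f) x = f (x * a) :=
  rfl

end Algebra

section Modules

variable (A : Type u) [Ring A]

/-- `X` belongs to the additive closure of `M`: it is (isomorphic to) a direct summand of a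
finite direct sum of copies of `M`. -/
def MemAdditiveClosure (M X : Type u) [AddCommGroup M] [Module A M]
    [AddCommGroup X] [Module A X] : Prop :=
  ∃ (m : ℕ) (i : X →ₗ[A] (Fin m → M)) (p : (Fin m → M) →ₗ[A] X), p ∘ₗ i = LinearMap.id

/-- `Ext^i_A(X, Y) = 0` for all `i > 0`. -/
def PositiveExtVanish (X Y : Type u) [AddCommGroup X] [Module A X]
    [AddCommGroup Y] [Module A Y] : Prop :=
  ∀ i : ℕ, 0 < i → Subsingleton (Abelian.Ext (ModuleCat.of A X) (ModuleCat.of A Y) i)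

/-- There is an exact sequence `0 → T_r → ⋯ → T_1 → T_0 → X → 0` in which all `T_i` lie in the
additive closure of `T`. It is written as an infinite sequence with `T_i = 0` for `i > r`. -/
def HasFiniteAddResolution (T X : Type u) [AddCommGroup T] [Module A T]
    [AddCommGroup X] [Module A X] : Prop :=
  ∃ (r : ℕ) (Y : ℕ → ModuleCat.{u} A) (d : ∀ i, Y (i + 1) →ₗ[A] Y i) (e : Y 0 →ₗ[A] X),
    (∀ i, MemAdditiveClosure A T (Y i)) ∧
    (∀ i, r < i → Subsingleton (Y i)) ∧
    Function.Surjective e ∧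
    Function.Exact (d 0) e ∧
    ∀ i, Function.Exact (d (i + 1)) (d i)

/-- The finitely generated module `M` is an additive generator of the full subcategory
`{X | Ext^i_A(X, T) = 0 for all i > 0}` of finitely generated `A`-modules: this subcategory is
the additive closure of `M`. -/
structure IsAdditiveGeneratorLeftPerp (T M : Type u) [AddCommGroup T] [Module A T]
    [AddCommGroup M] [Module A M] : Prop where
  finite : Module.Finite A M
  mem_iff : ∀ (X : Type u) [AddCommGroup X] [Module A X] [Module.Finite A X],
    PositiveExtVanish A X T ↔ MemAdditiveClosure A M X

/-- The two-sided ideal `[T]` of `End_A(M)`: the endomorphisms of `M` that factor through a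
module in the additive closure of `T`, equivalently through some finite direct sum `T^m`. -/
def factorIdeal (T M : Type u) [AddCommGroup T] [Module A T]
    [AddCommGroup M] [Module A M] : Ideal (Module.End A M) where
  carrier := {f | ∃ (m : ℕ) (g : M →ₗ[A] (Fin m → T)) (h : (Fin m → T) →ₗ[A] M), h ∘ₗ g = f}
  zero_mem' := ⟨0, 0, 0, rfl⟩
  add_mem' := by
    rintro _ _ ⟨m, g, h, rfl⟩ ⟨m', g', h', rfl⟩
    let e : (Fin (m + m') → T) ≃ₗ[A] ((Fin m → T) × (Fin m' → T)) :=
      (LinearEquiv.funCongrLeft A T finSumFinEquiv).trans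
        (LinearEquiv.sumArrowLequivProdArrow (Fin m) (Fin m') A T)
    refine ⟨m + m', e.symm.toLinearMap ∘ₗ g.prod g', h.coprod h' ∘ₗ e.toLinearMap, ?_⟩
    ext x
    simp
  smul_mem' := by
    rintro c _ ⟨m, g, h, rfl⟩
    exact ⟨m, g, c ∘ₗ h, rfl⟩

instance (T M : Type u) [AddCommGroup T] [Module A T] [AddCommGroup M] [Module A M] :
    (factorIdeal A T M).IsTwoSided where
  mul_mem_of_left := by
    rintro _ c ⟨m, g, h, rfl⟩
    exact ⟨m, g ∘ₗ c, h, rfl⟩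

/-- The algebra `End_A(M)/[T]`. -/
abbrev RelStableEnd (T M : Type u) [AddCommGroup T] [Module A T]
    [AddCommGroup M] [Module A M] : Type u :=
  Module.End A M ⧸ factorIdeal A T M

end Modules

/-- `T` is a cotilting module (of finite injective dimension) over the finite-dimensional
`k`-algebra `A`. -/
structure IsCotilting (k A T : Type u) [Field k] [Ring A] [Algebra k A]
    [AddCommGroup T] [Module A T] : Prop where
  finite : Module.Finite A T
  finite_injectiveDimension : ∃ d : ℕ, HasInjectiveDimensionLE (ModuleCat.of A T) d
  ext_self : PositiveExtVanish A T T
  resolution : HasFiniteAddResolution A T (DualModule k A)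

end RelStableAuslander

/-! Write `Γ` for `End_A(M)/[T]` and `F X` for the maps `X → M` modulo those factoring through `add
T`. This contravariant functor kills `add T` and sends `add M` to projective `Γ`-modules. A finitely
generated `Γ`-module `N` is the cokernel of `F φ` for some `φ : M^a → M^b`. Adding to `φ` a left
`add T`-approximation `M^a → T^c` does not change this cokernel. It makes the map injective with
cokernel in the left perpendicular category, because `T` is cotilting. So `N` is the cokernel of `F
Y → F X` for a short exact sequence `0 → X → Y → Z → 0` in that category.

As `Ext^1(Z, T) = 0`, the sequence `F Z → F Y → F X` is exact, so the cokernel of `F Z → F Y` is a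
first syzygy of `N`. If `0 → X → P → W → 0` is exact with `P` in `add T` and `W` in the
perpendicular category, then `Y → Z` is completed to a short exact sequence `0 → Y → Z ⊕ P → W → 0`,
and the extra `P` is invisible to `F`. The syzygy thus has the same form as `N`, with the triple
`(X, Y, Z)` replaced by `(Y, Z ⊕ P, W)`.

Three such rotations replace each term by a cosyzygy, up to summands in `add T`. Global dimension at
most `n` gives every finitely generated module of the perpendicular category an `add T`-coresolution
of length `n`. After `3n` rotations the first term therefore lies in `add T` and the syzygy is zero:
the projective dimension of `N` is less than `3n`. This is
`hasProjectiveDimensionLT_of_hasAddCoresolution`, resting on `IsCotilting.exists_cosyzygy`,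
`IsShortExact.rotate` and `StableHom.exact`.

Baer's criterion passes from finitely generated to all modules, and `k`-duality passes from left to
right modules. -/

namespace RelStableAuslander


/-! ### Vanishing of Ext along short exact sequences of modules -/

section ExtVanishing

variable {A : Type u} [Ring A]

/-- `Ext^i_A(X, Y) = 0`. -/
abbrev ExtVanish (A : Type u) [Ring A] (X Y : Type u) [AddCommGroup X] [Module A X]
    [AddCommGroup Y] [Module A Y] (i : ℕ) : Prop :=
  Subsingleton (Abelian.Ext (ModuleCat.of A X) (ModuleCat.of A Y) i)

variable {X₁ X₂ X₃ Y : Type u} [AddCommGroup X₁] [Module A X₁] [AddCommGroup X₂] [Module A X₂]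
  [AddCommGroup X₃] [Module A X₃] [AddCommGroup Y] [Module A Y]

/-- `0 → X₁ → X₂ → X₃ → 0` is a short exact sequence of modules. -/
structure IsShortExact (f : X₁ →ₗ[A] X₂) (g : X₂ →ₗ[A] X₃) : Prop where
  injective : Function.Injective f
  exact : Function.Exact f g
  surjective : Function.Surjective g

theorem IsShortExact.of_injective {f : X₁ →ₗ[A] X₂} (hf : Function.Injective f) :
    IsShortExact f (LinearMap.range f).mkQ :=
  ⟨hf, LinearMap.exact_map_mkQ_range f, Submodule.mkQ_surjective _⟩

theorem IsShortExact.of_surjective {g : X₂ →ₗ[A] X₃} (hg : Function.Surjective g) :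
    IsShortExact (LinearMap.ker g).subtype g :=
  ⟨Submodule.subtype_injective _, LinearMap.exact_subtype_ker_map g, hg⟩

namespace IsShortExact

variable {f : X₁ →ₗ[A] X₂} {g : X₂ →ₗ[A] X₃} (h : IsShortExact f g)
include h

theorem shortExact : (ModuleCat.shortComplexOfCompEqZero f g
    h.exact.linearMap_comp_eq_zero).ShortExact :=
  ModuleCat.shortComplex_shortExact _ h.exact h.injective h.surjective

theorem ext_covariant_right {i : ℕ} (h₂ : ExtVanish A Y X₂ i) (h₁ : ExtVanish A Y X₁ (i + 1)) :
    ExtVanish A Y X₃ i := by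
  refine subsingleton_of_forall_eq 0 fun x => ?_
  obtain ⟨y, rfl⟩ := Abelian.Ext.covariant_sequence_exact₃ _ h.shortExact x rfl (h₁.elim _ _)
  rw [h₂.elim y 0, Abelian.Ext.zero_comp]

theorem ext_contravariant_left {i : ℕ} (h₂ : ExtVanish A X₂ Y i)
    (h₃ : ExtVanish A X₃ Y (i + 1)) : ExtVanish A X₁ Y i := by
  refine subsingleton_of_forall_eq 0 fun x => ?_
  obtain ⟨y, rfl⟩ := Abelian.Ext.contravariant_sequence_exact₁ h.shortExact _ x
    (add_comm 1 i) (h₃.elim _ _)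
  rw [h₂.elim y 0, Abelian.Ext.comp_zero]

theorem ext_contravariant_right {i : ℕ} (h₁ : ExtVanish A X₁ Y i)
    (h₂ : ExtVanish A X₂ Y (i + 1)) : ExtVanish A X₃ Y (i + 1) := by
  refine subsingleton_of_forall_eq 0 fun x => ?_
  obtain ⟨y, rfl⟩ := Abelian.Ext.contravariant_sequence_exact₃ h.shortExact _ x (h₂.elim _ _)
    (add_comm 1 i)
  rw [h₁.elim y 0, Abelian.Ext.comp_zero]

theorem exists_lift (h₁ : ExtVanish A Y X₁ 1) (φ : Y →ₗ[A] X₃) :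
    ∃ ψ : Y →ₗ[A] X₂, g ∘ₗ ψ = φ := by
  obtain ⟨x, hx⟩ := Abelian.Ext.covariant_sequence_exact₃ (ModuleCat.of A Y) h.shortExact
    (Abelian.Ext.mk₀ (ModuleCat.ofHom φ)) rfl (h₁.elim _ _)
  obtain ⟨ψ, rfl⟩ := Abelian.Ext.homEquiv₀.symm.surjective x
  refine ⟨ψ.hom, ?_⟩
  rw [Abelian.Ext.homEquiv₀_symm_apply, Abelian.Ext.mk₀_comp_mk₀] at hx
  exact congrArg ModuleCat.Hom.hom (Abelian.Ext.homEquiv₀.symm.injective hx)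

theorem exists_extend (h₃ : ExtVanish A X₃ Y 1) (φ : X₁ →ₗ[A] Y) :
    ∃ ψ : X₂ →ₗ[A] Y, ψ ∘ₗ f = φ := by
  obtain ⟨x, hx⟩ := Abelian.Ext.contravariant_sequence_exact₁ h.shortExact (ModuleCat.of A Y)
    (Abelian.Ext.mk₀ (ModuleCat.ofHom φ)) rfl (h₃.elim _ _)
  obtain ⟨ψ, rfl⟩ := Abelian.Ext.homEquiv₀.symm.surjective x
  refine ⟨ψ.hom, ?_⟩
  rw [Abelian.Ext.homEquiv₀_symm_apply, Abelian.Ext.mk₀_comp_mk₀] at hx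
  exact congrArg ModuleCat.Hom.hom (Abelian.Ext.homEquiv₀.symm.injective hx)

/-- Since `Ext^1(X₂, Y) = 0`, each class in `Ext^1(X₃, Y)` is the pushout of the extension along
some `φ : X₁ → Y`; once `φ` extends to `X₂`, that pushout splits. -/
theorem ext_one_right_of_extend (h₂ : ExtVanish A X₂ Y 1)
    (hf : ∀ φ : X₁ →ₗ[A] Y, ∃ ψ : X₂ →ₗ[A] Y, ψ ∘ₗ f = φ) : ExtVanish A X₃ Y 1 := by
  refine subsingleton_of_forall_eq 0 fun x => ?_
  obtain ⟨y, rfl⟩ := Abelian.Ext.contravariant_sequence_exact₃ h.shortExact _ x (h₂.elim _ _)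
    (add_zero 1)
  obtain ⟨φ, rfl⟩ := Abelian.Ext.homEquiv₀.symm.surjective y
  obtain ⟨ψ, hψ⟩ := hf φ.hom
  have : φ = (ModuleCat.shortComplexOfCompEqZero f g h.exact.linearMap_comp_eq_zero).f ≫
      ModuleCat.ofHom ψ := ModuleCat.hom_ext hψ.symm
  rw [this, Abelian.Ext.homEquiv₀_symm_apply, ← Abelian.Ext.mk₀_comp_mk₀,
    ShortComplex.ShortExact.extClass_comp_assoc]

/-- A map vanishing on the kernel of a surjection descends. -/
theorem exists_desc (φ : X₂ →ₗ[A] Y) (hφ : φ ∘ₗ f = 0) : ∃ ψ : X₃ →ₗ[A] Y, ψ ∘ₗ g = φ := by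
  have hk : LinearMap.ker g ≤ LinearMap.ker φ := by
    intro x hx
    obtain ⟨y, rfl⟩ := (h.exact x).1 hx
    exact LinearMap.congr_fun hφ y
  refine ⟨(LinearMap.ker g).liftQ φ hk ∘ₗ
    (g.quotKerEquivOfSurjective h.surjective).symm.toLinearMap, LinearMap.ext fun x => ?_⟩
  have : (g.quotKerEquivOfSurjective h.surjective).symm (g x) = (LinearMap.ker g).mkQ x := by
    rw [LinearEquiv.symm_apply_eq]; rfl
  simp only [LinearMap.comp_apply, LinearEquiv.coe_coe, this]
  rfl

end IsShortExact

end ExtVanishing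

/-! ### Additive closures -/

section AdditiveClosure

variable {A : Type u} [Ring A] {M X Y Z : Type u} [AddCommGroup M] [Module A M]
  [AddCommGroup X] [Module A X] [AddCommGroup Y] [Module A Y] [AddCommGroup Z] [Module A Z]

theorem memAdditiveClosure_iff :
    MemAdditiveClosure A M X ↔ ∃ (m : ℕ) (a : Fin m → X →ₗ[A] M) (b : Fin m → M →ₗ[A] X),
      ∑ j, b j ∘ₗ a j = LinearMap.id := by
  constructor
  · rintro ⟨m, i, p, hp⟩
    refine ⟨m, fun j => LinearMap.proj j ∘ₗ i, fun j => p ∘ₗ LinearMap.single A (fun _ : Fin m => M) j, ?_⟩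
    rw [← hp]
    ext x
    simp only [LinearMap.sum_apply, LinearMap.comp_apply, ← map_sum]
    congr 1
    exact LinearMap.sum_single_apply _ (i x)
  · rintro ⟨m, a, b, h⟩
    refine ⟨m, LinearMap.pi a, ∑ j, b j ∘ₗ LinearMap.proj j, ?_⟩
    rw [← h]
    ext x
    simp

theorem MemAdditiveClosure.of_retract (hX : MemAdditiveClosure A M X) (i : Y →ₗ[A] X)
    (p : X →ₗ[A] Y) (hp : p ∘ₗ i = LinearMap.id) : MemAdditiveClosure A M Y := by
  obtain ⟨m, i', p', h⟩ := hX
  refine ⟨m, i' ∘ₗ i, p ∘ₗ p', ?_⟩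
  rw [LinearMap.comp_assoc, ← LinearMap.comp_assoc i, h, LinearMap.id_comp, hp]

theorem MemAdditiveClosure.pow (M : Type u) [AddCommGroup M] [Module A M] (m : ℕ) :
    MemAdditiveClosure A M (Fin m → M) :=
  ⟨m, LinearMap.id, LinearMap.id, rfl⟩

theorem MemAdditiveClosure.prod (hX : MemAdditiveClosure A M X) (hY : MemAdditiveClosure A M Y) :
    MemAdditiveClosure A M (X × Y) := by
  rw [memAdditiveClosure_iff] at *
  obtain ⟨m, a, b, h⟩ := hX
  obtain ⟨m', a', b', h'⟩ := hY
  refine ⟨m + m', Fin.append (fun j => a j ∘ₗ LinearMap.fst A X Y)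
    (fun j => a' j ∘ₗ LinearMap.snd A X Y), Fin.append (fun j => LinearMap.inl A X Y ∘ₗ b j)
    (fun j => LinearMap.inr A X Y ∘ₗ b' j), ?_⟩
  rw [Fin.sum_univ_add]
  simp only [Fin.append_left, Fin.append_right]
  have e : ∀ x, ∑ j, b j (a j x) = x := fun x => by
    simpa using LinearMap.congr_fun h x
  have e' : ∀ x, ∑ j, b' j (a' j x) = x := fun x => by
    simpa using LinearMap.congr_fun h' x
  refine LinearMap.ext fun x => Prod.ext ?_ ?_
  · simp [Prod.fst_sum, e]
  · simp [Prod.snd_sum, e']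

theorem MemAdditiveClosure.finite [Module.Finite A M] (hX : MemAdditiveClosure A M X) :
    Module.Finite A X := by
  obtain ⟨m, i, p, h⟩ := hX
  exact Module.Finite.of_surjective p fun x => ⟨i x, LinearMap.congr_fun h x⟩

theorem MemAdditiveClosure.ext_left (hX : MemAdditiveClosure A M X) {i : ℕ}
    (h : ExtVanish A M Z i) : ExtVanish A X Z i := by
  obtain ⟨m, a, b, hab⟩ := memAdditiveClosure_iff.1 hX
  refine subsingleton_of_forall_eq 0 fun x => ?_
  have hid : 𝟙 (ModuleCat.of A X) = ∑ j, ModuleCat.ofHom (a j) ≫ ModuleCat.ofHom (b j) := by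
    apply ModuleCat.hom_ext
    rw [ModuleCat.hom_sum]
    exact hab.symm
  rw [← Abelian.Ext.mk₀_id_comp x, hid, Abelian.Ext.mk₀_sum, Abelian.Ext.sum_comp]
  refine Finset.sum_eq_zero fun j _ => ?_
  rw [← Abelian.Ext.mk₀_comp_mk₀_assoc, h.elim ((Abelian.Ext.mk₀ _).comp x _) 0,
    Abelian.Ext.comp_zero]

theorem MemAdditiveClosure.ext_right (hX : MemAdditiveClosure A M X) {i : ℕ}
    (h : ExtVanish A Z M i) : ExtVanish A Z X i := by
  obtain ⟨m, a, b, hab⟩ := memAdditiveClosure_iff.1 hX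
  refine subsingleton_of_forall_eq 0 fun x => ?_
  have hid : 𝟙 (ModuleCat.of A X) = ∑ j, ModuleCat.ofHom (a j) ≫ ModuleCat.ofHom (b j) := by
    apply ModuleCat.hom_ext
    rw [ModuleCat.hom_sum]
    exact hab.symm
  rw [← Abelian.Ext.comp_mk₀_id x, hid, Abelian.Ext.mk₀_sum, Abelian.Ext.comp_sum]
  refine Finset.sum_eq_zero fun j _ => ?_
  rw [← Abelian.Ext.mk₀_comp_mk₀, ← Abelian.Ext.comp_assoc_of_second_deg_zero,
    h.elim (x.comp (Abelian.Ext.mk₀ _) _) 0, Abelian.Ext.zero_comp]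

end AdditiveClosure


/-! ### Coresolutions by `add T` for a cotilting module `T` -/

section Coresolution

variable {A : Type u} [Ring A] {T X Y Z : Type u} [AddCommGroup T] [Module A T]
  [AddCommGroup X] [Module A X] [AddCommGroup Y] [Module A Y] [AddCommGroup Z] [Module A Z]

theorem MemAdditiveClosure.positiveExtVanish (hX : MemAdditiveClosure A T X)
    (hT : PositiveExtVanish A T T) : PositiveExtVanish A X T :=
  fun i hi => hX.ext_left (hT i hi)

theorem IsShortExact.positiveExtVanish_left {f : X →ₗ[A] Y} {g : Y →ₗ[A] Z}
    (h : IsShortExact f g) (hY : PositiveExtVanish A Y T) (hZ : PositiveExtVanish A Z T) :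
    PositiveExtVanish A X T :=
  fun i hi => h.ext_contravariant_left (hY i hi) (hZ (i + 1) i.succ_pos)

theorem IsShortExact.positiveExtVanish_right {f : X →ₗ[A] Y} {g : Y →ₗ[A] Z}
    (h : IsShortExact f g) (hX : PositiveExtVanish A X T) (hY : PositiveExtVanish A Y T)
    (hf : ∀ φ : X →ₗ[A] T, ∃ ψ : Y →ₗ[A] T, ψ ∘ₗ f = φ) : PositiveExtVanish A Z T
  | 1, _ => h.ext_one_right_of_extend (hY 1 one_pos) hf
  | i + 2, _ => h.ext_contravariant_right (hX (i + 1) i.succ_pos) (hY (i + 2) (i + 1).succ_pos)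

/-- If `X` is in the left perpendicular category of `T`, then every map from `X` to a module with
a finite resolution by `add T` lifts to the first term of such a resolution. -/
theorem HasFiniteAddResolution.exists_lift (hY : HasFiniteAddResolution A T Y)
    (hX : PositiveExtVanish A X T) (φ : X →ₗ[A] Y) :
    ∃ (m : ℕ) (e : (Fin m → T) →ₗ[A] Y) (ψ : X →ₗ[A] (Fin m → T)), e ∘ₗ ψ = φ := by
  obtain ⟨r, P, d, e, hP, hr, he, hd, hdd⟩ := hY
  -- Dimension shifting down from the vanishing end of the resolution: `m` bounds the number of
  -- terms left, and all images inherit the vanishing of Ext from `X`.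
  have key : ∀ m i, r ≤ i + m → ∀ j, 0 < j → ExtVanish A X (LinearMap.range (d i)) j := by
    intro m
    induction m with
    | zero =>
      intro i hi j hj
      have hs := hr (i + 1) (by omega)
      have : Subsingleton (LinearMap.range (d i)) :=
        (LinearMap.surjective_rangeRestrict (d i)).subsingleton
      have hz : MemAdditiveClosure A T (LinearMap.range (d i)) :=
        ⟨0, 0, 0, LinearMap.ext fun x => Subsingleton.elim _ _⟩
      exact hz.ext_right (hX j hj)
    | succ m ih =>
      intro i hi j hj
      have hse : IsShortExact (LinearMap.range (d (i + 1))).subtype (d i).rangeRestrict := by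
        refine ⟨Submodule.subtype_injective _, fun y => ?_, LinearMap.surjective_rangeRestrict _⟩
        have := hdd i y
        rw [← Subtype.coe_inj]
        simpa using this
      exact hse.ext_covariant_right ((hP (i + 1)).ext_right (hX j hj))
        (ih (i + 1) (by omega) (j + 1) j.succ_pos)
  have hse : IsShortExact (LinearMap.range (d 0)).subtype e :=
    ⟨Submodule.subtype_injective _, fun y => by simpa using hd y, he⟩
  obtain ⟨ψ, hψ⟩ := hse.exists_lift (key r 0 (by omega) 1 one_pos) φ
  obtain ⟨m, i, p, hip⟩ := hP 0
  refine ⟨m, e ∘ₗ p, i ∘ₗ ψ, ?_⟩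
  rw [LinearMap.comp_assoc, ← LinearMap.comp_assoc ψ, hip, LinearMap.id_comp, hψ]

variable (k : Type u) [Field k] [Algebra k A]

/-- The maps to the dual of the algebra separate points. -/
theorem exists_dualModule_apply_ne_zero {x : X} (hx : x ≠ 0) :
    ∃ φ : X →ₗ[A] DualModule k A, φ x ≠ 0 := by
  let : Module k X := Module.restrictScalars k A X
  have : IsScalarTower k A X := IsScalarTower.restrictScalars k A X
  obtain ⟨f, hf⟩ : ∃ f : Module.Dual k X, f x ≠ 0 := by
    by_contra! h
    exact hx ((Module.forall_dual_apply_eq_zero_iff k x).1 h)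
  let φ : X →ₗ[A] DualModule k A :=
    { toFun := fun y => (f ∘ₗ (LinearMap.toSpanSingleton A X y).restrictScalars k : A →ₗ[k] k)
      map_add' := fun y z => LinearMap.ext fun a => by
        change f (a • (y + z)) = f (a • y) + f (a • z)
        rw [smul_add, map_add]
      map_smul' := fun b y => LinearMap.ext fun a => by
        change f (a • b • y) = f ((a * b) • y)
        rw [mul_smul] }
  refine ⟨φ, fun h => hf ?_⟩
  have h1 : f ((1 : A) • x) = 0 := LinearMap.congr_fun (show (φ x : A →ₗ[k] k) = 0 from h) 1
  rwa [one_smul] at h1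

/-- Left approximations by the additive closure of `T`. -/
theorem exists_left_approximation [Module.Finite k A] [Module.Finite A X] [Module.Finite A T] :
    ∃ (m : ℕ) (f : X →ₗ[A] (Fin m → T)),
      ∀ φ : X →ₗ[A] T, ∃ ψ : (Fin m → T) →ₗ[A] T, ψ ∘ₗ f = φ := by
  let : Module k X := Module.restrictScalars k A X
  have : IsScalarTower k A X := IsScalarTower.restrictScalars k A X
  let : Module k T := Module.restrictScalars k A T
  have : IsScalarTower k A T := IsScalarTower.restrictScalars k A T
  have : Module.Finite k X := Module.Finite.trans A X
  have : Module.Finite k T := Module.Finite.trans A T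
  have : SMulCommClass A k T := IsScalarTower.to_smulCommClass'
  have : Module.Finite k (X →ₗ[A] T) :=
    Module.Finite.of_injective (LinearMap.restrictScalarsₗ k A X T k)
      (LinearMap.restrictScalars_injective k)
  obtain ⟨m, s, hs⟩ := Module.Finite.exists_fin (R := k) (M := X →ₗ[A] T)
  -- The components of the approximation are a finite `k`-spanning family of `Hom_A(X, T)`.
  refine ⟨m, LinearMap.pi s, fun φ => ?_⟩
  obtain ⟨c, hc⟩ := (Submodule.mem_span_range_iff_exists_fun k).1 (hs ▸ Submodule.mem_top (x := φ))
  refine ⟨∑ j, c j • LinearMap.proj j, ?_⟩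
  rw [← hc]
  ext x
  simp

variable {k}

/-- Every module in the left perpendicular category of a cotilting module `T` embeds in a power of
`T` with cokernel again in the left perpendicular category. -/
theorem IsCotilting.exists_cosyzygy [Module.Finite k A] (hT : IsCotilting k A T)
    [Module.Finite A X] (hX : PositiveExtVanish A X T) :
    ∃ (m : ℕ) (f : X →ₗ[A] (Fin m → T)), Function.Injective f ∧
      (∀ φ : X →ₗ[A] T, ∃ ψ : (Fin m → T) →ₗ[A] T, ψ ∘ₗ f = φ) ∧
      PositiveExtVanish A ((Fin m → T) ⧸ LinearMap.range f) T := by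
  have := hT.finite
  obtain ⟨m, f, hf⟩ := exists_left_approximation (A := A) (X := X) (T := T) k
  -- Maps to `DA` separate points and lift through powers of `T`, hence factor through the
  -- approximation `f`; so nothing nonzero lies in its kernel.
  have hinj : Function.Injective f := by
    rw [injective_iff_map_eq_zero]
    intro x hfx
    by_contra hx
    obtain ⟨φ, hφ⟩ := exists_dualModule_apply_ne_zero (A := A) k hx
    obtain ⟨m', e, ψ, rfl⟩ := hT.resolution.exists_lift hX φ
    refine hφ ?_
    have : ψ x = 0 := by
      ext j
      obtain ⟨χ, hχ⟩ := hf (LinearMap.proj j ∘ₗ ψ)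
      have := LinearMap.congr_fun hχ x
      simp only [LinearMap.comp_apply, hfx, map_zero] at this
      exact this.symm
    rw [LinearMap.comp_apply, this, map_zero]
  exact ⟨m, f, hinj, hf, (IsShortExact.of_injective hinj).positiveExtVanish_right hX
    ((MemAdditiveClosure.pow T m).positiveExtVanish hT.ext_self) hf⟩

/-- There is an exact sequence `0 → X → T⁰ → ⋯ → T^j → 0` with all `T^i` in the additive closure
of `T`. -/
def HasAddCoresolution (A T : Type u) [Ring A] [AddCommGroup T] [Module A T] :
    ℕ → ModuleCat.{u} A → Prop
  | 0, X => MemAdditiveClosure A T X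
  | j + 1, X => ∃ (Y Z : ModuleCat.{u} A) (f : X →ₗ[A] Y) (g : Y →ₗ[A] Z),
      IsShortExact f g ∧ MemAdditiveClosure A T Y ∧ HasAddCoresolution A T j Z

theorem HasAddCoresolution.positiveExtVanish (hT : PositiveExtVanish A T T) :
    ∀ {j : ℕ} {X : ModuleCat.{u} A}, HasAddCoresolution A T j X → PositiveExtVanish A X T
  | 0, _, h => MemAdditiveClosure.positiveExtVanish h hT
  | _ + 1, _, ⟨_, _, _, _, hfg, hY, hZ⟩ =>
    hfg.positiveExtVanish_left (hY.positiveExtVanish hT) (hZ.positiveExtVanish hT)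

theorem HasAddCoresolution.finite [IsNoetherianRing A] [Module.Finite A T] :
    ∀ {j : ℕ} {X : ModuleCat.{u} A}, HasAddCoresolution A T j X → Module.Finite A X
  | 0, _, h => MemAdditiveClosure.finite h
  | _ + 1, _, ⟨_, _, f, _, hfg, hY, _⟩ =>
    have := hY.finite
    Module.Finite.of_injective f hfg.injective

theorem HasAddCoresolution.prod (hY : MemAdditiveClosure A T Y) :
    ∀ {j : ℕ} {X : ModuleCat.{u} A}, HasAddCoresolution A T j X →
      HasAddCoresolution A T j (ModuleCat.of A (X × Y))
  | 0, _, h => MemAdditiveClosure.prod h hY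
  | _ + 1, _, ⟨P, Z, f, g, hfg, hP, hZ⟩ =>
    ⟨ModuleCat.of A (P × Y), Z, f.prodMap LinearMap.id, g ∘ₗ LinearMap.fst A P Y,
      ⟨hfg.injective.prodMap Function.injective_id, fun ⟨p, y⟩ => by
          simpa using hfg.exact p,
        hfg.surjective.comp Prod.fst_surjective⟩, hP.prod hY, hZ⟩

/-- Passing to a cosyzygy lowers by one the degree in which Ext into the module vanishes. In degree
one the sequence `0 → X → T^m → Z → 0` splits, so `X` is a summand of `T^m`. -/
theorem IsCotilting.hasAddCoresolution [Module.Finite k A] (hT : IsCotilting k A T) :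
    ∀ (j : ℕ) (X : ModuleCat.{u} A) [Module.Finite A X], PositiveExtVanish A X T →
      (∀ (Z : Type u) [AddCommGroup Z] [Module A Z], PositiveExtVanish A Z T →
        ExtVanish A Z X (j + 1)) → HasAddCoresolution A T j X
  | 0, X, _, hX, h => by
    obtain ⟨m, f, hf, -, hZ⟩ := hT.exists_cosyzygy hX
    obtain ⟨p, hp⟩ := (IsShortExact.of_injective hf).exists_extend (h _ hZ) LinearMap.id
    exact ⟨m, f, p, hp⟩
  | j + 1, X, _, hX, h => by
    have := hT.finite
    obtain ⟨m, f, hf, -, hZ⟩ := hT.exists_cosyzygy hX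
    refine ⟨ModuleCat.of A (Fin m → T), ModuleCat.of A ((Fin m → T) ⧸ LinearMap.range f), f,
      (LinearMap.range f).mkQ, .of_injective hf, .pow T m,
      hT.hasAddCoresolution j _ hZ fun Z _ _ hZ' => ?_⟩
    exact (IsShortExact.of_injective hf).ext_covariant_right
      ((MemAdditiveClosure.pow T m).ext_right (hZ' _ j.succ_pos)) (h Z hZ')

end Coresolution


/-! ### Homs into `M` modulo maps factoring through `add T` -/

section StableHom

variable {A : Type u} [Ring A] (T M X : Type u) [AddCommGroup T] [Module A T]
  [AddCommGroup M] [Module A M] [AddCommGroup X] [Module A X]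

variable (A) in
/-- The maps `X → M` which factor through the additive closure of `T`. -/
def factorSubmodule : Submodule (Module.End A M) (X →ₗ[A] M) where
  carrier := {f | ∃ (m : ℕ) (g : X →ₗ[A] (Fin m → T)) (h : (Fin m → T) →ₗ[A] M), h ∘ₗ g = f}
  zero_mem' := ⟨0, 0, 0, rfl⟩
  add_mem' := by
    rintro _ _ ⟨m, g, h, rfl⟩ ⟨m', g', h', rfl⟩
    let e : (Fin (m + m') → T) ≃ₗ[A] ((Fin m → T) × (Fin m' → T)) :=
      (LinearEquiv.funCongrLeft A T finSumFinEquiv).trans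
        (LinearEquiv.sumArrowLequivProdArrow (Fin m) (Fin m') A T)
    refine ⟨m + m', e.symm.toLinearMap ∘ₗ g.prod g', h.coprod h' ∘ₗ e.toLinearMap, ?_⟩
    ext x
    simp
  smul_mem' := by
    rintro c _ ⟨m, g, h, rfl⟩
    exact ⟨m, g, c ∘ₗ h, rfl⟩

variable (A) in
/-- The maps `X → M` modulo those factoring through the additive closure of `T`. -/
def StableHom : Type u := (X →ₗ[A] M) ⧸ factorSubmodule A T M X

instance : AddCommGroup (StableHom A T M X) :=
  inferInstanceAs (AddCommGroup ((X →ₗ[A] M) ⧸ factorSubmodule A T M X))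

instance : Module (Module.End A M) (StableHom A T M X) :=
  inferInstanceAs (Module (Module.End A M) ((X →ₗ[A] M) ⧸ factorSubmodule A T M X))

variable (A) in
theorem stableHom_isTorsionBySet :
    Module.IsTorsionBySet (Module.End A M) (StableHom A T M X) (factorIdeal A T M) := by
  intro x c
  obtain ⟨f, rfl⟩ := Submodule.mkQ_surjective (factorSubmodule A T M X) x
  obtain ⟨c, m, g, h, rfl⟩ := c
  exact (Submodule.Quotient.mk_eq_zero _).2 ⟨m, g ∘ₗ f, h, rfl⟩

instance : Module (RelStableEnd A T M) (StableHom A T M X) :=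
  (stableHom_isTorsionBySet A T M X).module

variable {X}

/-- The class of a map in the stable Hom. -/
def StableHom.mk : (X →ₗ[A] M) →+ StableHom A T M X :=
  (factorSubmodule A T M X).mkQ.toAddMonoidHom

theorem StableHom.mk_surjective : Function.Surjective (StableHom.mk (A := A) T M (X := X)) :=
  Submodule.mkQ_surjective _

variable {T M}

theorem StableHom.mk_eq_zero {f : X →ₗ[A] M} : StableHom.mk T M f = 0 ↔
    ∃ (m : ℕ) (g : X →ₗ[A] (Fin m → T)) (h : (Fin m → T) →ₗ[A] M), h ∘ₗ g = f :=
  Submodule.Quotient.mk_eq_zero _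

theorem StableHom.smul_mk (c : Module.End A M) (f : X →ₗ[A] M) :
    (Ideal.Quotient.mk (factorIdeal A T M) c) • StableHom.mk T M f = StableHom.mk T M (c ∘ₗ f) :=
  rfl

variable {Y Z : Type u} [AddCommGroup Y] [Module A Y] [AddCommGroup Z] [Module A Z]

variable (T M) in
/-- Precomposition on stable Hom. -/
def StableHom.map (φ : X →ₗ[A] Y) :
    StableHom A T M Y →ₗ[RelStableEnd A T M] StableHom A T M X where
  toFun := QuotientAddGroup.lift (factorSubmodule A T M Y).toAddSubgroup
    ((StableHom.mk T M).comp
      (AddMonoidHom.mk' (fun f : Y →ₗ[A] M => f ∘ₗ φ) fun f g => LinearMap.add_comp φ g f))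
    (by
      rintro _ ⟨m, g, h, rfl⟩
      exact StableHom.mk_eq_zero.2 ⟨m, g ∘ₗ φ, h, rfl⟩)
  map_add' x y := map_add _ x y
  map_smul' c x := by
    obtain ⟨c, rfl⟩ := Ideal.Quotient.mk_surjective c
    obtain ⟨f, rfl⟩ := StableHom.mk_surjective T M x
    rfl

theorem StableHom.map_mk (φ : X →ₗ[A] Y) (f : Y →ₗ[A] M) :
    StableHom.map T M φ (StableHom.mk T M f) = StableHom.mk T M (f ∘ₗ φ) :=
  rfl

theorem StableHom.subsingleton (hX : MemAdditiveClosure A T X) :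
    Subsingleton (StableHom A T M X) := by
  obtain ⟨m, i, p, h⟩ := hX
  refine subsingleton_of_forall_eq 0 fun x => ?_
  obtain ⟨f, rfl⟩ := StableHom.mk_surjective T M x
  refine StableHom.mk_eq_zero.2 ⟨m, i, f ∘ₗ p, ?_⟩
  rw [LinearMap.comp_assoc, h, LinearMap.comp_id]

/-- The map from the stable Hom on `X` to the stable endomorphism ring given by
precomposition with a map `M → X`. -/
def StableHom.eval (b : M →ₗ[A] X) :
    StableHom A T M X →ₗ[RelStableEnd A T M] RelStableEnd A T M where
  toFun := QuotientAddGroup.lift (factorSubmodule A T M X).toAddSubgroup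
    ((Ideal.Quotient.mk (factorIdeal A T M)).toAddMonoidHom.comp
      (AddMonoidHom.mk' (fun f : X →ₗ[A] M => (f ∘ₗ b : Module.End A M))
        fun f g => LinearMap.add_comp b g f))
    (by
      rintro _ ⟨m, g, h, rfl⟩
      exact Ideal.Quotient.eq_zero_iff_mem.2 ⟨m, g ∘ₗ b, h, rfl⟩)
  map_add' x y := map_add _ x y
  map_smul' c x := by
    obtain ⟨c, rfl⟩ := Ideal.Quotient.mk_surjective c
    obtain ⟨f, rfl⟩ := StableHom.mk_surjective T M x
    rfl

theorem StableHom.eval_mk (b : M →ₗ[A] X) (f : X →ₗ[A] M) :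
    StableHom.eval b (StableHom.mk T M f) =
      Ideal.Quotient.mk (factorIdeal A T M) (f ∘ₗ b : Module.End A M) :=
  rfl

/-- The stable Hom takes the additive closure of `M` to that of the regular module. -/
theorem StableHom.memAdditiveClosure (hX : MemAdditiveClosure A M X) :
    MemAdditiveClosure (RelStableEnd A T M) (RelStableEnd A T M) (StableHom A T M X) := by
  obtain ⟨m, a, b, h⟩ := memAdditiveClosure_iff.1 hX
  refine memAdditiveClosure_iff.2 ⟨m, fun j => StableHom.eval (b j),
    fun j => LinearMap.toSpanSingleton _ _ (StableHom.mk T M (a j)), LinearMap.ext fun x => ?_⟩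
  obtain ⟨f, rfl⟩ := StableHom.mk_surjective T M x
  simp only [LinearMap.comp_apply, LinearMap.sum_apply,
    LinearMap.toSpanSingleton_apply, StableHom.eval_mk, StableHom.smul_mk, LinearMap.id_apply]
  rw [← map_sum]
  congr 1
  conv_rhs => rw [← LinearMap.comp_id f, ← h]
  ext x
  simp

theorem StableHom.projective (hX : MemAdditiveClosure A M X) :
    Module.Projective (RelStableEnd A T M) (StableHom A T M X) := by
  obtain ⟨m, i, p, h⟩ := StableHom.memAdditiveClosure (T := T) hX
  exact Module.Projective.of_split i p h

/-- If `u ∘ f` factors as `q ∘ p` through `T^m`, extend `p` along `f` to a map on `Y`. Subtracting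
its composite with `q` from `u` leaves the stable class unchanged and gives a map that kills `X`,
hence descends to `Z`. -/
theorem StableHom.exact {f : X →ₗ[A] Y} {g : Y →ₗ[A] Z} (h : IsShortExact f g)
    (hf : ∀ φ : X →ₗ[A] T, ∃ ψ : Y →ₗ[A] T, ψ ∘ₗ f = φ) :
    Function.Exact (StableHom.map T M g) (StableHom.map T M f) := by
  intro y
  obtain ⟨u, rfl⟩ := StableHom.mk_surjective T M y
  constructor
  · intro hu
    rw [StableHom.map_mk, StableHom.mk_eq_zero] at hu
    obtain ⟨m, p, q, hpq⟩ := hu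
    choose ψ hψ using fun j => hf (LinearMap.proj j ∘ₗ p)
    have hp : LinearMap.pi ψ ∘ₗ f = p := by
      ext x j
      exact LinearMap.congr_fun (hψ j) x
    obtain ⟨w, hw⟩ := h.exists_desc (u - q ∘ₗ LinearMap.pi ψ) (by
      rw [LinearMap.sub_comp, LinearMap.comp_assoc, hp, hpq, sub_self])
    refine ⟨StableHom.mk T M w, ?_⟩
    rw [StableHom.map_mk, hw, map_sub, sub_eq_self]
    exact StableHom.mk_eq_zero.2 ⟨m, _, _, rfl⟩
  · rintro ⟨z, hz⟩
    obtain ⟨w, rfl⟩ := StableHom.mk_surjective T M z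
    rw [← hz, StableHom.map_mk, StableHom.map_mk, LinearMap.comp_assoc,
      h.exact.linearMap_comp_eq_zero, LinearMap.comp_zero, map_zero]

theorem StableHom.range_map_prod (f : X →ₗ[A] Y) (g : X →ₗ[A] Z) (hZ : MemAdditiveClosure A T Z) :
    LinearMap.range (StableHom.map T M (f.prod g)) = LinearMap.range (StableHom.map T M f) := by
  apply le_antisymm
  · rintro _ ⟨y, rfl⟩
    obtain ⟨u, rfl⟩ := StableHom.mk_surjective T M y
    refine ⟨StableHom.mk T M (u ∘ₗ LinearMap.inl A Y Z), ?_⟩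
    have := StableHom.subsingleton (M := M) hZ
    rw [StableHom.map_mk, StableHom.map_mk]
    have e : u ∘ₗ f.prod g = (u ∘ₗ LinearMap.inl A Y Z) ∘ₗ f + (u ∘ₗ LinearMap.inr A Y Z) ∘ₗ g := by
      ext x
      simp [← map_add]
    rw [e, map_add, ← StableHom.map_mk g,
      Subsingleton.elim (StableHom.mk T M (u ∘ₗ LinearMap.inr A Y Z)) 0, map_zero, add_zero]
  · rintro _ ⟨y, rfl⟩
    obtain ⟨u, rfl⟩ := StableHom.mk_surjective T M y
    exact ⟨StableHom.mk T M (u ∘ₗ LinearMap.fst A Y Z), rfl⟩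

/-- The syzygy step: the cokernel of the map on stable Homs attached to the first map of a short
exact sequence is resolved by the cokernel attached to the second one. -/
theorem StableHom.hasProjectiveDimensionLT_succ {f : X →ₗ[A] Y} {g : Y →ₗ[A] Z}
    (h : IsShortExact f g) (hf : ∀ φ : X →ₗ[A] T, ∃ ψ : Y →ₗ[A] T, ψ ∘ₗ f = φ)
    (hX : MemAdditiveClosure A M X) {s : ℕ}
    (hs : HasProjectiveDimensionLT (ModuleCat.of (RelStableEnd A T M)
      (StableHom A T M Y ⧸ LinearMap.range (StableHom.map T M g))) s) :
    HasProjectiveDimensionLT (ModuleCat.of (RelStableEnd A T M)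
      (StableHom A T M X ⧸ LinearMap.range (StableHom.map T M f))) (s + 1) := by
  have hk : LinearMap.range (StableHom.map T M g) ≤ LinearMap.ker (StableHom.map T M f) :=
    (LinearMap.exact_iff.1 (StableHom.exact h hf)).ge
  -- By exactness, the cokernel of `map g` embeds in the projective module `StableHom A T M X` with
  -- image the range of `map f`.
  let F := (LinearMap.range (StableHom.map T M g)).liftQ (StableHom.map T M f) hk
  have hse : IsShortExact F (LinearMap.range (StableHom.map T M f)).mkQ := by
    refine ⟨?_, ?_, Submodule.mkQ_surjective _⟩
    · rw [← LinearMap.ker_eq_bot, Submodule.ker_liftQ_eq_bot']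
      exact (LinearMap.exact_iff.1 (StableHom.exact h hf)).symm
    · rw [LinearMap.exact_iff, Submodule.ker_mkQ, Submodule.range_liftQ]
  have := StableHom.projective (T := T) hX
  have hp : Projective (ModuleCat.of (RelStableEnd A T M) (StableHom A T M X)) :=
    (IsProjective.iff_projective _).1 this
  have h1 : HasProjectiveDimensionLT (ModuleCat.of (RelStableEnd A T M) (StableHom A T M X)) 1 :=
    inferInstance
  exact hse.shortExact.hasProjectiveDimensionLT_X₃ s hs
    (hasProjectiveDimensionLT_of_ge _ 1 _ (by omega))

end StableHom

/-! ### Rotating short exact sequences and counting syzygies -/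

section Syzygies

variable {A : Type u} [Ring A] {T M X Y Z : Type u} [AddCommGroup T] [Module A T]
  [AddCommGroup M] [Module A M] [AddCommGroup X] [Module A X] [AddCommGroup Y] [Module A Y]
  [AddCommGroup Z] [Module A Z]

/-- Rotation of a short exact sequence `0 → X → Y → Z → 0` along a map from `Y` to the middle term
of a short exact sequence `0 → X → P → W → 0`. -/
theorem IsShortExact.rotate {P W : Type u} [AddCommGroup P] [Module A P] [AddCommGroup W]
    [Module A W] {f : X →ₗ[A] Y} {g : Y →ₗ[A] Z} {i : X →ₗ[A] P} {p : P →ₗ[A] W}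
    (h : IsShortExact f g) (h' : IsShortExact i p) (e : Y →ₗ[A] P) (he : e ∘ₗ f = i) :
    ∃ q : Z × P →ₗ[A] W, IsShortExact (g.prod e) q := by
  -- The pushout of `f` and `i` is an extension of `W` by `Y` and of `Z` by `P`. The map `e` splits
  -- the latter, which identifies the pushout with `Z × P`.
  obtain ⟨w, hw⟩ := h.exists_desc (p ∘ₗ e) (by
    rw [LinearMap.comp_assoc, he, h'.exact.linearMap_comp_eq_zero])
  have hw' : ∀ y, w (g y) = p (e y) := fun y => LinearMap.congr_fun hw y
  have he' : ∀ x, e (f x) = i x := fun x => LinearMap.congr_fun he x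
  refine ⟨(-w).coprod p, ?_, ?_, fun c => ?_⟩
  · rw [injective_iff_map_eq_zero]
    intro y hy
    obtain ⟨h1, h2⟩ := Prod.mk.inj (hy : (g y, e y) = (0, 0))
    obtain ⟨x, rfl⟩ := (h.exact y).1 h1
    rw [he'] at h2
    rw [(injective_iff_map_eq_zero i).1 h'.injective x h2, map_zero]
  · rintro ⟨z, c⟩
    change -w z + p c = 0 ↔ ∃ y, (g y, e y) = (z, c)
    simp only [Prod.mk.injEq]
    constructor
    · intro hz
      obtain ⟨y, rfl⟩ := h.surjective z
      have : p (c - e y) = 0 := by rw [map_sub, ← hw', ← hz]; abel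
      obtain ⟨x, hx⟩ := (h'.exact _).1 this
      refine ⟨y + f x, ?_, ?_⟩
      · rw [map_add, h.exact.apply_apply_eq_zero, add_zero]
      · rw [map_add, he', hx]; abel
    · rintro ⟨y, rfl, rfl⟩
      rw [hw', neg_add_cancel]
  · obtain ⟨c, rfl⟩ := h'.surjective c
    exact ⟨(0, c), by simp⟩

/-- The three lengths sum to `s`. One rotation takes a single step in the coresolution of the first
term, which moves to the last place as `W`, so the lengths for `s + 1` become those for `s`. -/
theorem hasProjectiveDimensionLT_of_hasAddCoresolution [IsNoetherianRing A] [Module.Finite A T]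
    (hT : PositiveExtVanish A T T) (hM : IsAdditiveGeneratorLeftPerp A T M) :
    ∀ (s : ℕ) {X Y Z : ModuleCat.{u} A} {f : X →ₗ[A] Y} {g : Y →ₗ[A] Z},
      IsShortExact f g → HasAddCoresolution A T ((s + 2) / 3) X →
      HasAddCoresolution A T ((s + 1) / 3) Y → HasAddCoresolution A T (s / 3) Z →
      HasProjectiveDimensionLT (ModuleCat.of (RelStableEnd A T M)
        (StableHom A T M X ⧸ LinearMap.range (StableHom.map T M f))) s
  | 0, X, _, _, f, _, _, hX, _, _ => by
    have := StableHom.subsingleton (M := M) (T := T) (X := X) hX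
    have := (Submodule.mkQ_surjective (LinearMap.range (StableHom.map T M f))).subsingleton
    exact (ModuleCat.isZero_of_subsingleton _).hasProjectiveDimensionLT_zero
  | s + 1, X, Y, Z, f, g, h, hX, hY, hZ => by
    have hXfin := hX.finite
    have hXM : MemAdditiveClosure A M X := (hM.mem_iff X).1 (hX.positiveExtVanish hT)
    have hZT := hZ.positiveExtVanish hT
    rw [show (s + 1 + 2) / 3 = s / 3 + 1 by omega] at hX
    obtain ⟨P, W, i, p, hip, hP, hW⟩ := hX
    obtain ⟨e, he⟩ := h.exists_extend (hP.ext_right (hZT 1 one_pos)) i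
    obtain ⟨q, hq⟩ := h.rotate hip e he
    have ih := hasProjectiveDimensionLT_of_hasAddCoresolution hT hM s
      (X := Y) (Y := ModuleCat.of A (Z × P)) (Z := W) hq hY (hZ.prod hP) hW
    rw [StableHom.range_map_prod g e hP] at ih
    exact StableHom.hasProjectiveDimensionLT_succ h (fun φ => h.exists_extend (hZT 1 one_pos) φ)
      hXM ih

end Syzygies


/-! ### Finitely generated modules over the relative stable endomorphism ring -/

section Presentation

variable {k A : Type u} [Field k] [Ring A] [Algebra k A] {T M : Type u} [AddCommGroup T]
  [Module A T] [AddCommGroup M] [Module A M]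

theorem exists_algebra_relStableEnd (k : Type u) [Field k] [Algebra k A] [Module.Finite k A]
    [Module.Finite A M] :
    ∃ _ : Algebra k (RelStableEnd A T M), Module.Finite k (RelStableEnd A T M) := by
  let : Module k M := Module.restrictScalars k A M
  have : IsScalarTower k A M := IsScalarTower.restrictScalars k A M
  have : Module.Finite k M := Module.Finite.trans A M
  have : SMulCommClass A k M := IsScalarTower.to_smulCommClass'
  have : Module.Finite k (Module.End A M) :=
    Module.Finite.of_injective (LinearMap.restrictScalarsₗ k A M M k)
      (LinearMap.restrictScalars_injective k)
  exact ⟨inferInstance, Module.Finite.of_surjective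
    (Ideal.Quotient.mkₐ k (factorIdeal A T M)).toLinearMap Ideal.Quotient.mk_surjective⟩

/-- A finitely presented module over the relative stable endomorphism ring is the cokernel of
a map on stable Homs induced by a map between powers of `M`. -/
theorem exists_stableHom_presentation [IsNoetherianRing (RelStableEnd A T M)]
    (N : Type u) [AddCommGroup N] [Module (RelStableEnd A T M) N]
    [Module.Finite (RelStableEnd A T M) N] :
    ∃ (a b : ℕ) (φ : (Fin a → M) →ₗ[A] (Fin b → M)), Nonempty
      ((StableHom A T M (Fin a → M) ⧸ LinearMap.range (StableHom.map T M φ))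
        ≃ₗ[RelStableEnd A T M] N) := by
  obtain ⟨a, s, hs⟩ := Module.Finite.exists_fin (R := RelStableEnd A T M) (M := N)
  let π : StableHom A T M (Fin a → M) →ₗ[RelStableEnd A T M] N :=
    Fintype.linearCombination (RelStableEnd A T M) s ∘ₗ
      LinearMap.pi fun j => StableHom.eval (LinearMap.single A (fun _ : Fin a => M) j)
  have hπ : Function.Surjective π := by
    intro x
    obtain ⟨c, rfl⟩ := (Submodule.mem_span_range_iff_exists_fun _).1
      (hs ▸ Submodule.mem_top (x := x))
    choose c' hc' using fun j => Ideal.Quotient.mk_surjective (c j)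
    refine ⟨StableHom.mk T M (∑ j, c' j ∘ₗ LinearMap.proj j), ?_⟩
    simp only [π, LinearMap.comp_apply, Fintype.linearCombination_apply, LinearMap.pi_apply,
      StableHom.eval_mk]
    refine Finset.sum_congr rfl fun j _ => ?_
    rw [← hc' j]
    congr 2
    ext x
    rw [LinearMap.comp_apply, LinearMap.sum_apply, Finset.sum_eq_single j]
    · simp
    · intro i _ hi
      simp [Pi.single_eq_of_ne hi]
    · simp
  have hfin : Module.Finite (RelStableEnd A T M) (StableHom A T M (Fin a → M)) :=
    (StableHom.memAdditiveClosure (.pow M a)).finite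
  -- Generators of the kernel are classes of maps `M^a → M`; representatives of them are the
  -- components of the presenting map.
  obtain ⟨b, κ, hκ⟩ := Submodule.fg_iff_exists_fin_generating_family.1
    (IsNoetherian.noetherian (LinearMap.ker π))
  choose f hf using fun j => StableHom.mk_surjective T M (κ j)
  have hrange : LinearMap.range (StableHom.map T M (LinearMap.pi f)) = LinearMap.ker π := by
    rw [← hκ]
    apply le_antisymm
    · rintro _ ⟨y, rfl⟩
      obtain ⟨v, rfl⟩ := StableHom.mk_surjective T M y
      have e : v ∘ₗ LinearMap.pi f =
          ∑ j, (v ∘ₗ LinearMap.single A (fun _ : Fin b => M) j) ∘ₗ f j := by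
        refine LinearMap.ext fun x => ?_
        simp only [LinearMap.comp_apply, LinearMap.sum_apply, ← map_sum]
        congr 1
        exact (LinearMap.sum_single_apply (fun _ : Fin b => M) (LinearMap.pi f x)).symm
      rw [StableHom.map_mk, e, map_sum]
      refine Submodule.sum_mem _ fun j _ => ?_
      rw [← StableHom.smul_mk, hf]
      exact Submodule.smul_mem _ _ (Submodule.subset_span ⟨j, rfl⟩)
    · rw [Submodule.span_le]
      rintro _ ⟨j, rfl⟩
      refine ⟨StableHom.mk T M (LinearMap.proj j), ?_⟩
      rw [StableHom.map_mk, LinearMap.proj_pi, hf]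
  exact ⟨a, b, LinearMap.pi f, ⟨(Submodule.quotEquivOfEq _ _ hrange).trans
    (π.quotKerEquivOfSurjective hπ)⟩⟩

theorem hasProjectiveDimensionLT_of_finite [Module.Finite k A] (n : ℕ)
    (hT : IsCotilting k A T) (hA : HasGlobalDimensionLE A n)
    (hM : IsAdditiveGeneratorLeftPerp A T M) (N : ModuleCat.{u} (RelStableEnd A T M))
    [Module.Finite (RelStableEnd A T M) N] : HasProjectiveDimensionLT N (3 * n) := by
  have := hM.finite
  have := hT.finite
  have : IsNoetherianRing A := .of_finite k A
  have : IsNoetherianRing (RelStableEnd A T M) := by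
    obtain ⟨_, _⟩ := exists_algebra_relStableEnd (A := A) (T := T) (M := M) k
    exact .of_finite k _
  have hcores : ∀ (X : ModuleCat.{u} A) [Module.Finite A X], PositiveExtVanish A X T →
      HasAddCoresolution A T n X := fun X _ hX =>
    hT.hasAddCoresolution n X hX fun Z _ _ _ =>
      have := hA (ModuleCat.of A Z)
      HasProjectiveDimensionLT.subsingleton _ (n + 1) (n + 1) le_rfl _
  have perp : ∀ (X : Type u) [AddCommGroup X] [Module A X], MemAdditiveClosure A M X →
      PositiveExtVanish A X T := fun X _ _ hX =>
    have := hX.finite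
    (hM.mem_iff X).2 hX
  obtain ⟨a, b, φ, ⟨e⟩⟩ := exists_stableHom_presentation (A := A) (T := T) (M := M) N
  have hX := perp _ (MemAdditiveClosure.pow M a)
  -- Adding `ι` makes the map injective and lets every map `M^a → T` extend along it, while the
  -- summand `T^c` does not affect the cokernel on stable Homs.
  obtain ⟨c, ι, hι, hext, -⟩ := hT.exists_cosyzygy hX
  have hTc : MemAdditiveClosure A T (Fin c → T) := .pow T c
  have hY := perp _ ((MemAdditiveClosure.pow M b).prod
    ((hM.mem_iff _).1 (hTc.positiveExtVanish hT.ext_self)))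
  have hse : IsShortExact (φ.prod ι) (LinearMap.range (φ.prod ι)).mkQ :=
    .of_injective fun x y h => hι (congrArg Prod.snd h)
  have hZ := hse.positiveExtVanish_right hX hY fun ψ => by
    obtain ⟨χ, hχ⟩ := hext ψ
    exact ⟨χ ∘ₗ LinearMap.snd A _ _, by rw [LinearMap.comp_assoc, LinearMap.snd_prod, hχ]⟩
  have key := hasProjectiveDimensionLT_of_hasAddCoresolution hT.ext_self hM (3 * n)
    (X := ModuleCat.of A (Fin a → M)) (Y := ModuleCat.of A ((Fin b → M) × (Fin c → T)))
    (Z := ModuleCat.of A (((Fin b → M) × (Fin c → T)) ⧸ LinearMap.range (φ.prod ι))) hse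
    (by rw [show (3 * n + 2) / 3 = n by omega]; exact hcores _ hX)
    (by rw [show (3 * n + 1) / 3 = n by omega]; exact hcores _ hY)
    (by rw [show 3 * n / 3 = n by omega]; exact hcores _ hZ)
  rw [StableHom.range_map_prod φ ι hTc] at key
  exact hasProjectiveDimensionLT_of_iso (LinearEquiv.toModuleIso e) (3 * n)

end Presentation

/-! ### Reducing global dimension to finitely generated modules -/

section GlobalDimension

variable {R : Type u} [Ring R]

theorem injective_of_ext_quotient {Y : ModuleCat.{u} R}
    (h : ∀ I : Ideal R, ExtVanish R (R ⧸ I) Y 1) : Injective Y := by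
  have hB : Module.Baer R Y := fun I g => by
    have hse : IsShortExact I.subtype I.mkQ :=
      ⟨Submodule.subtype_injective _, LinearMap.exact_subtype_mkQ I, Submodule.mkQ_surjective I⟩
    obtain ⟨g', hg'⟩ := hse.exists_extend (h I) g
    exact ⟨g', fun x hx => LinearMap.congr_fun hg' ⟨x, hx⟩⟩
  exact (Module.injective_iff_injective_object R Y).1 hB.injective

/-- Dimension shifting along embeddings into injectives reduces to `d = 0`, which is Baer's
criterion. -/
theorem hasInjectiveDimensionLT_of_ext_quotient : ∀ (d : ℕ) {Y : ModuleCat.{u} R},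
    (∀ I : Ideal R, ExtVanish R (R ⧸ I) Y (d + 1)) → HasInjectiveDimensionLT Y (d + 1)
  | 0, _, h => injective_iff_hasInjectiveDimensionLT_one.1 (injective_of_ext_quotient h)
  | d + 1, Y, h => by
    obtain ⟨J, _, f, _⟩ := EnoughInjectives.presentation Y
    have hse : IsShortExact f.hom (LinearMap.range f.hom).mkQ :=
      .of_injective ((ModuleCat.mono_iff_injective f).1 ‹_›)
    have hJ : HasInjectiveDimensionLT J 1 := inferInstance
    refine hse.shortExact.hasInjectiveDimensionLT_X₁ (d + 1) ?_
      (hasInjectiveDimensionLT_of_ge _ 1 _ (by omega))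
    exact hasInjectiveDimensionLT_of_ext_quotient d fun I => hse.ext_covariant_right
      (HasInjectiveDimensionLT.subsingleton J 1 _ (by omega) _) (h I)

theorem hasInjectiveDimensionLT_of_hasGlobalDimensionLT {d : ℕ} (h : HasGlobalDimensionLT R d)
    (Y : ModuleCat.{u} R) : HasInjectiveDimensionLT Y d :=
  .mk fun _ hi Z e => have := h Z; e.eq_zero_of_hasProjectiveDimensionLT d hi

/-- Global dimension is detected on finitely generated modules. -/
theorem hasGlobalDimensionLT_of_finite {d : ℕ}
    (h : ∀ (N : ModuleCat.{u} R) [Module.Finite R N], HasProjectiveDimensionLT N d) :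
    HasGlobalDimensionLT R d := by
  intro N
  obtain _ | d := d
  · have := h (ModuleCat.of R R)
    have : Subsingleton R := ModuleCat.subsingleton_of_isZero
      (isZero_of_hasProjectiveDimensionLT_zero (ModuleCat.of R R))
    have : Subsingleton N := Module.subsingleton R N
    exact (ModuleCat.isZero_of_subsingleton N).hasProjectiveDimensionLT_zero
  · refine .mk fun i hi Y e => ?_
    have : HasInjectiveDimensionLT Y (d + 1) :=
      hasInjectiveDimensionLT_of_ext_quotient d fun I =>
        have := h (ModuleCat.of R (R ⧸ I))
        HasProjectiveDimensionLT.subsingleton _ (d + 1) (d + 1) le_rfl _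
    exact e.eq_zero_of_hasInjectiveDimensionLT (d + 1) hi

end GlobalDimension

/-! ### Passing to right modules by `k`-duality -/

section OppositeRing

open MulOpposite

/-- The `k`-dual of a right `R`-module, as a left `R`-module. -/
@[nolint unusedArguments]
def OpDual (k R N : Type u) [Field k] [Ring R] [AddCommGroup N] [Module Rᵐᵒᵖ N] [Module k N] :
    Type u :=
  N →ₗ[k] k

variable (k R : Type u) [Field k] [Ring R] [Algebra k R]
  (N : Type u) [AddCommGroup N] [Module Rᵐᵒᵖ N] [Module k N] [IsScalarTower k Rᵐᵒᵖ N]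

instance : AddCommGroup (OpDual k R N) := inferInstanceAs (AddCommGroup (N →ₗ[k] k))

instance : FunLike (OpDual k R N) N k := inferInstanceAs (FunLike (N →ₗ[k] k) N k)

instance : Module R (OpDual k R N) where
  smul r f := LinearMap.comp (f : N →ₗ[k] k) (Algebra.lsmul k k N (op r))
  one_smul f := LinearMap.ext fun x => congrArg (f : N → k) (one_smul Rᵐᵒᵖ x)
  mul_smul r s f := LinearMap.ext fun x =>
    congrArg (f : N → k) (mul_smul (op s) (op r) x)
  smul_zero _ := LinearMap.ext fun _ => rfl
  smul_add _ _ _ := LinearMap.ext fun _ => rfl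
  add_smul r s f := LinearMap.ext fun x =>
    (congrArg (f : N → k) (add_smul (op r) (op s) x)).trans
      (LinearMap.map_add (f : N →ₗ[k] k) _ _)
  zero_smul f := LinearMap.ext fun x =>
    (congrArg (f : N → k) (zero_smul Rᵐᵒᵖ x)).trans (LinearMap.map_zero (f : N →ₗ[k] k))

namespace OpDual

variable {k R N} {P Q : Type u} [AddCommGroup P] [Module Rᵐᵒᵖ P] [Module k P]
  [IsScalarTower k Rᵐᵒᵖ P]

/-- A functional, as an element of the dual. -/
def of : (N →ₗ[k] k) ≃+ OpDual k R N := AddEquiv.refl _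

theorem of_symm_smul (r : R) (f : OpDual k R N) (x : N) :
    of.symm (r • f) x = of.symm f (op r • x) :=
  rfl

theorem algebraMap_smul_eq (c : k) (f : OpDual k R N) :
    algebraMap k R c • f = of (c • of.symm f) :=
  of.symm.injective (LinearMap.ext fun x => by
    rw [of_symm_smul, AddEquiv.symm_apply_apply, LinearMap.smul_apply, ← map_smul,
      ← MulOpposite.algebraMap_apply, algebraMap_smul])

/-- The transpose of a map of right modules. -/
def map (φ : N →ₗ[Rᵐᵒᵖ] P) : OpDual k R P →ₗ[R] OpDual k R N where
  toFun f := of (of.symm f ∘ₗ φ.restrictScalars k)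
  map_add' _ _ := rfl
  map_smul' r f := of.symm.injective (LinearMap.ext fun x =>
    congrArg (of.symm f) (map_smul φ (op r) x).symm)

theorem of_symm_map (φ : N →ₗ[Rᵐᵒᵖ] P) (f : OpDual k R P) (x : N) :
    of.symm (map φ f) x = of.symm f (φ x) :=
  rfl

omit [Algebra k R] [IsScalarTower k Rᵐᵒᵖ N] in
theorem ext {f g : OpDual k R N} (h : ∀ x, of.symm f x = of.symm g x) : f = g :=
  of.symm.injective (LinearMap.ext h)

theorem isShortExact_map [AddCommGroup Q] [Module Rᵐᵒᵖ Q] [Module k Q] [IsScalarTower k Rᵐᵒᵖ Q]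
    {f : N →ₗ[Rᵐᵒᵖ] P} {g : P →ₗ[Rᵐᵒᵖ] Q} (h : IsShortExact f g) :
    IsShortExact (map (k := k) g) (map f) := by
  refine ⟨fun a b hab => ext fun x => ?_, fun a => ⟨fun ha => ?_, ?_⟩, fun a => ?_⟩
  · obtain ⟨x, rfl⟩ := h.surjective x
    rw [← of_symm_map, ← of_symm_map, hab]
  · have hk : LinearMap.ker (g.restrictScalars k) ≤ LinearMap.ker (of.symm a) := by
      intro x hx
      obtain ⟨y, rfl⟩ := (h.exact x).1 hx
      exact LinearMap.congr_fun (congrArg of.symm ha) y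
    obtain ⟨s, hs⟩ := (g.restrictScalars k).exists_rightInverse_of_surjective
      (LinearMap.range_eq_top.2 h.surjective)
    refine ⟨of (of.symm a ∘ₗ s), ext fun x => ?_⟩
    have : s (g x) - x ∈ LinearMap.ker (of.symm a) := hk (by
      rw [LinearMap.mem_ker, map_sub, sub_eq_zero]
      exact LinearMap.congr_fun hs (g x))
    rw [LinearMap.mem_ker, map_sub, sub_eq_zero] at this
    exact this
  · rintro ⟨b, rfl⟩
    refine ext fun x => ?_
    rw [of_symm_map, of_symm_map, h.exact.apply_apply_eq_zero]
    simp
  · obtain ⟨s, hs⟩ := (f.restrictScalars k).exists_leftInverse_of_injective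
      (LinearMap.ker_eq_bot.2 h.injective)
    refine ⟨of (of.symm a ∘ₗ s), ext fun x => ?_⟩
    exact congrArg (of.symm a) (LinearMap.congr_fun hs x)

omit [Algebra k R] [IsScalarTower k Rᵐᵒᵖ N] in
theorem subsingleton_of_subsingleton [Subsingleton (OpDual k R N)] : Subsingleton N := by
  refine subsingleton_of_forall_eq 0 fun x =>
    (Module.forall_dual_apply_eq_zero_iff k x).1 fun f => ?_
  exact LinearMap.congr_fun (congrArg of.symm (Subsingleton.elim (of (R := R) f) 0)) x

theorem injective_pow (m : ℕ) : Module.Injective R (OpDual k R (Fin m → Rᵐᵒᵖ)) := by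
  refine ⟨fun X Y _ _ _ _ f hf g => ?_⟩
  let : Module k X := Module.restrictScalars k R X
  have : IsScalarTower k R X := IsScalarTower.restrictScalars k R X
  let : Module k Y := Module.restrictScalars k R Y
  have : IsScalarTower k R Y := IsScalarTower.restrictScalars k R Y
  obtain ⟨s, hs⟩ := (f.restrictScalars k).exists_leftInverse_of_injective
    (LinearMap.ker_eq_bot.2 hf)
  have hs' : ∀ x, s (f x) = x := fun x => LinearMap.congr_fun hs x
  let φ (i : Fin m) : X →ₗ[k] k :=
    { toFun x := of.symm (g x) (Pi.single i 1)
      map_add' x y := by rw [map_add, map_add, LinearMap.add_apply]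
      map_smul' c x := by
        rw [← algebraMap_smul R c x, map_smul, of_symm_smul, RingHom.id_apply, ← map_smul]
        congr 1
        rw [← MulOpposite.algebraMap_apply, algebraMap_smul] }
  -- The retraction `s` is only `k`-linear, but the scalars `p i` act on `y` before `s` is applied,
  -- so `y ↦ h y` is `R`-linear.
  let h (y : Y) : (Fin m → Rᵐᵒᵖ) →ₗ[k] k :=
    { toFun p := ∑ i, φ i (s (unop (p i) • y))
      map_add' p q := by
        rw [← Finset.sum_add_distrib]
        refine Finset.sum_congr rfl fun i _ => ?_
        rw [Pi.add_apply, MulOpposite.unop_add, add_smul, map_add, map_add]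
      map_smul' c p := by
        simp only [Pi.smul_apply, unop_smul, smul_assoc, map_smul, Finset.smul_sum,
          RingHom.id_apply] }
  let H : Y →ₗ[R] OpDual k R (Fin m → Rᵐᵒᵖ) :=
    { toFun y := of (h y)
      map_add' y z := ext fun p => by
        change ∑ i, φ i (s (unop (p i) • (y + z))) =
          ∑ i, φ i (s (unop (p i) • y)) + ∑ i, φ i (s (unop (p i) • z))
        simp only [smul_add, map_add, Finset.sum_add_distrib]
      map_smul' r y := ext fun p => by
        change ∑ i, φ i (s (unop (p i) • r • y)) = ∑ i, φ i (s (unop (op r * p i) • y))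
        simp only [unop_mul, unop_op, mul_smul] }
  refine ⟨H, fun x => ext fun p => ?_⟩
  change ∑ i, φ i (s (unop (p i) • f x)) = _
  have e : ∀ i, φ i (s (unop (p i) • f x)) = of.symm (g x) (p i • Pi.single i 1) := fun i => by
    rw [← map_smul, hs']
    change of.symm (g (unop (p i) • x)) (Pi.single i 1) = _
    rw [map_smul, of_symm_smul, op_unop]
  simp only [e, ← map_sum]
  congr 1
  ext i
  simp [Finset.sum_apply, Pi.single_apply]

/-- A finitely generated right module is projective if its dual is injective. -/
theorem projective_of_injective [Module.Finite k R] [Module.Finite Rᵐᵒᵖ N]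
    [Module.Injective R (OpDual k R N)] : Module.Projective Rᵐᵒᵖ N := by
  obtain ⟨m, π, hπ⟩ := Module.Finite.exists_fin' Rᵐᵒᵖ N
  have hinj := (isShortExact_map (k := k) (IsShortExact.of_surjective hπ)).injective
  obtain ⟨s, hs⟩ := Module.Injective.out (map (k := k) π) hinj LinearMap.id
  have hsk : ∀ (c : k) (f : OpDual k R (Fin m → Rᵐᵒᵖ)),
      of.symm (s (of (c • of.symm f))) = c • of.symm (s f) := fun c f => by
    rw [← algebraMap_smul_eq, map_smul, algebraMap_smul_eq, AddEquiv.symm_apply_apply]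
  let ev (x : N) : Module.Dual k (Module.Dual k (Fin m → Rᵐᵒᵖ)) :=
    { toFun f := of.symm (s (of f)) x
      map_add' f g := by simp only [map_add, LinearMap.add_apply]
      map_smul' c f := LinearMap.congr_fun (hsk c (of f)) x }
  -- The section of `π` is the transpose of the retraction `s`, read through the isomorphism of the
  -- finite-dimensional space `R^m` with its bidual.
  let σ₀ (x : N) : Fin m → Rᵐᵒᵖ := (Module.evalEquiv k (Fin m → Rᵐᵒᵖ)).symm (ev x)
  have hσ : ∀ (f : Module.Dual k (Fin m → Rᵐᵒᵖ)) (x : N),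
      f (σ₀ x) = of.symm (s (of f)) x := fun f x =>
    Module.apply_evalEquiv_symm_apply _ _ f (ev x)
  let σ : N →ₗ[Rᵐᵒᵖ] (Fin m → Rᵐᵒᵖ) :=
    { toFun := σ₀
      map_add' x y := Module.eval_apply_injective k (LinearMap.ext fun f => by
        change f _ = f _
        rw [map_add, hσ, hσ, hσ, map_add])
      map_smul' r x := Module.eval_apply_injective k (LinearMap.ext fun f => by
        change f _ = f (r • σ₀ x)
        have h1 : f (r • σ₀ x) = of.symm (unop r • of (R := R) f) (σ₀ x) := rfl
        rw [h1, hσ, hσ, AddEquiv.apply_symm_apply, map_smul s, of_symm_smul, op_unop]) }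
  refine Module.Projective.of_split σ π (LinearMap.ext fun x =>
    Module.eval_apply_injective k (LinearMap.ext fun f => ?_))
  change f (π (σ₀ x)) = f x
  have h1 : f (π (σ₀ x)) = of.symm (map π (of (R := R) f)) (σ₀ x) := rfl
  rw [h1, hσ, AddEquiv.apply_symm_apply, hs, LinearMap.id_apply, AddEquiv.symm_apply_apply]

end OpDual

variable {k R}

/-- Duality turns a free presentation of `N` into an embedding of the dual of `N` into an injective,
so syzygies of `N` correspond to cosyzygies of its dual. The zero module and the projective case are
separate starting points, since shifting only goes down to bound `1`. -/
theorem hasProjectiveDimensionLT_of_opDual [Module.Finite k R] :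
    ∀ (m : ℕ) (N : Type u) [AddCommGroup N] [Module Rᵐᵒᵖ N] [Module k N]
      [IsScalarTower k Rᵐᵒᵖ N] [Module.Finite Rᵐᵒᵖ N],
      HasInjectiveDimensionLT (ModuleCat.of R (OpDual k R N)) m →
      HasProjectiveDimensionLT (ModuleCat.of Rᵐᵒᵖ N) m
  | 0, N, _, _, _, _, _, h => by
    have : Subsingleton (OpDual k R N) :=
      ModuleCat.subsingleton_of_isZero
        (isZero_of_hasInjectiveDimensionLT_zero (ModuleCat.of R (OpDual k R N)))
    have : Subsingleton N := OpDual.subsingleton_of_subsingleton (k := k) (R := R)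
    exact (ModuleCat.isZero_of_subsingleton _).hasProjectiveDimensionLT_zero
  | 1, N, _, _, _, _, _, h => by
    have : Module.Injective R (OpDual k R N) :=
      (Module.injective_iff_injective_object R _).2
        (injective_iff_hasInjectiveDimensionLT_one.2 h)
    have : Module.Projective Rᵐᵒᵖ N := OpDual.projective_of_injective (k := k)
    exact projective_iff_hasProjectiveDimensionLT_one.1 ((IsProjective.iff_projective _).1 this)
  | m + 2, N, _, _, _, _, _, h => by
    have : IsNoetherianRing Rᵐᵒᵖ := .of_finite k _
    obtain ⟨a, π, hπ⟩ := Module.Finite.exists_fin' Rᵐᵒᵖ N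
    have hse := IsShortExact.of_surjective hπ
    have hinj := OpDual.injective_pow (k := k) (R := R) a
    rw [Module.injective_iff_injective_object] at hinj
    have h1 := injective_iff_hasInjectiveDimensionLT_one.1 hinj
    have hK := hasProjectiveDimensionLT_of_opDual (m + 1) (LinearMap.ker π)
      ((OpDual.isShortExact_map (k := k) hse).shortExact.hasInjectiveDimensionLT_X₃ (m + 1)
        (hasInjectiveDimensionLT_of_ge _ 1 _ (by omega)) h)
    have hP : Projective (ModuleCat.of Rᵐᵒᵖ (Fin a → Rᵐᵒᵖ)) :=
      (IsProjective.iff_projective _).1 inferInstance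
    have h2 := projective_iff_hasProjectiveDimensionLT_one.1 hP
    exact hse.shortExact.hasProjectiveDimensionLT_X₃ (m + 1) hK
      (hasProjectiveDimensionLT_of_ge _ 1 _ (by omega))

theorem HasGlobalDimensionLT.op [Module.Finite k R] {d : ℕ} (h : HasGlobalDimensionLT R d) :
    HasGlobalDimensionLT Rᵐᵒᵖ d := by
  refine hasGlobalDimensionLT_of_finite fun N _ => ?_
  let : Module k N := Module.restrictScalars k Rᵐᵒᵖ N
  have : IsScalarTower k Rᵐᵒᵖ N := IsScalarTower.restrictScalars k Rᵐᵒᵖ N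
  exact hasProjectiveDimensionLT_of_opDual (k := k) (R := R) d N
    (hasInjectiveDimensionLT_of_hasGlobalDimensionLT h _)

end OppositeRing

end RelStableAuslander

theorem theorem6p1 {k A : Type u} [Field k] [Ring A] [Algebra k A] [Module.Finite k A]
    {T M : Type u} [AddCommGroup T] [Module A T] [AddCommGroup M] [Module A M] (n : ℕ)
    (hT : RelStableAuslander.IsCotilting k A T)
    (hA : RelStableAuslander.HasGlobalDimensionLE A n)
    (hM : RelStableAuslander.IsAdditiveGeneratorLeftPerp A T M) :
    RelStableAuslander.HasGlobalDimensionLT (RelStableAuslander.RelStableEnd A T M) (3 * n) ∧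
      RelStableAuslander.HasGlobalDimensionLT
        (RelStableAuslander.RelStableEnd A T M)ᵐᵒᵖ (3 * n) := by
  have hl : RelStableAuslander.HasGlobalDimensionLT (RelStableAuslander.RelStableEnd A T M)
      (3 * n) :=
    RelStableAuslander.hasGlobalDimensionLT_of_finite fun N _ =>
      RelStableAuslander.hasProjectiveDimensionLT_of_finite n hT hA hM N
  have := hM.finite
  obtain ⟨_, _⟩ := RelStableAuslander.exists_algebra_relStableEnd (A := A) (T := T) (M := M) k
  exact ⟨hl, RelStableAuslander.HasGlobalDimensionLT.op (k := k) hl⟩
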